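/- Let $G=(V,E\cup A)$ be a finite mixed graph with a set $E$ of undirected edges and a set $A$ of directed arcs; parallel edges and arcs are allowed, loops are not. Both endpoints of an edge are regarded as its heads, while an arc has exactly one head, and a vertex is covered by an edge or arc if it is a head of it. A matching forest is a set $F\subseteq E\cup A$ such that (i) the underlying undirected multigraph of $F$ has no cycle (two parallel edges or arcs form a cycle) and (ii) every vertex is covered by at most one member of $F$. Suppose that $E\cup A$ can be partitioned into $k$ (possibly empty) matching forests. Then $E\cup A$ can be partitioned into $k$ (possibly empty) matching forests $F_1,\dots,F_k$ such that, with $M_i=F_i\cap E$ and $B_i=F_i\cap A$, for all $i,j\in\{1,\dots,k\}$, $$\bigl||F_i|-|F_j|\bigr|\le 2,\qquad \bigl||M_i|-|M_j|\bigr|\le 1,\qquad \bigl||B_i|-|B_j|\bigr|\le 2 .$$ -/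

import Mathlib

/-- A mixed graph on the vertex type `V`, whose undirected edges are the elements of `E` and whose
arcs are the elements of `A`.  Parallel edges and arcs are allowed, loops are not. -/
structure MixedGraph (V E A : Type*) where
  /-- the unordered pair of endpoints of an edge -/
  ends : E → Sym2 V
  /-- the tail of an arc -/
  tail : A → V
  /-- the head of an arc -/
  head : A → V
  ends_not_isDiag : ∀ e, ¬ (ends e).IsDiag
  tail_ne_head : ∀ a, tail a ≠ head a

namespace MixedGraph

variable {V E A : Type*} (G : MixedGraph V E A)

/-- The unordered pair of endpoints of an edge or arc, in the underlying undirected multigraph. -/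
def link : E ⊕ A → Sym2 V
  | Sum.inl e => G.ends e
  | Sum.inr a => s(G.tail a, G.head a)

/-- `v` is a head of (is covered by) `x`: both endpoints of an edge are its heads, and an arc has
exactly one head. -/
def Covers (v : V) : E ⊕ A → Prop
  | Sum.inl e => v ∈ G.ends e
  | Sum.inr a => G.head a = v

/-- The underlying undirected multigraph of `F` contains a cycle: there are `n ≥ 1` distinct
vertices `v 0, …, v (n - 1)` and distinct members `x 0, …, x (n - 1)` of `F` such that `x i` joins
`v i` to `v (i + 1)`, where `v n = v 0`.  In particular two parallel members form a cycle. -/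
def HasCycle (F : Finset (E ⊕ A)) : Prop :=
  ∃ (n : ℕ) (v : ℕ → V) (x : ℕ → E ⊕ A), 1 ≤ n ∧
    Set.InjOn v (Set.Iio n) ∧ Set.InjOn x (Set.Iio n) ∧ v n = v 0 ∧
    ∀ i < n, x i ∈ F ∧ G.link (x i) = s(v i, v (i + 1))

/-- A matching forest: the underlying undirected multigraph has no cycle, and every vertex is
covered at most once. -/
def IsMatchingForest (F : Finset (E ⊕ A)) : Prop :=
  ¬ G.HasCycle F ∧
    ∀ v : V, ∀ x ∈ F, ∀ y ∈ F, G.Covers v x → G.Covers v y → x = y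

/-- `F 0, …, F (k - 1)` is a partition of the set of all edges and arcs of `G` into `k` (possibly
empty) matching forests. -/
def IsMatchingForestPartition {k : ℕ} (F : Fin k → Finset (E ⊕ A)) : Prop :=
  (∀ i, G.IsMatchingForest (F i)) ∧ ∀ x : E ⊕ A, ∃! i, x ∈ F i

end MixedGraph

/-!
A potential argument reduces everything to two matching forests: among all partitions, take one
that minimizes lexicographically `∑ |Mᵢ|²` and then `∑ |Fᵢ|² + ∑ |Bᵢ|²`. If two of its members
violated a bound, replacing them by a balanced pair (`exists_balanced_pair`) would decrease this.

A set is a matching forest if and only if its edges form a matching, its arcs form a branching (no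
vertex is entered twice, and there is no directed cycle), and the endpoints of its edges are roots,
that is, are not entered by its arcs. So for `F₁` and `F₂` one has to split the edges into matchings
and the arcs into branchings with compatible root sets. By Edmonds' disjoint branchings theorem
(`exists_disjoint_isBranching`), the arcs split into branchings with root sets `R₁'` and `R₂'`
having the same union and intersection as the given root sets `R₁` and `R₂` whenever both meet every
source set, i.e. every nonempty vertex set that no arc enters (`exists_isBranching_of_roots`). For
this it is enough to pick a root of `F₁` and a root of `F₂` in each minimal source set on which `R₁`
and `R₂` are disjoint, and to keep these two apart. An involution `π` records the picked pairs
(`exists_involutive_forall_isSource`).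

What remains is a problem on colours `±1`: `σ` on edges, `σ = ±1` telling whether the edge is in
`F₁` or in `F₂`, and `ρ` on vertices, `ρ = ±1` telling whether the vertex is a root of `F₁` only or
of `F₂` only. Flipping the colours on a component of `dependenceGraph` respects all constraints. This
graph has maximum degree two, and `(-σ, ρ)` alternates along it, so that `∑ ρ - ∑ σ` is at most one
in absolute value on each component; contracting the vertices gives the same for `∑ σ`. Hence each
component contributes a vector with entries in `{-1, 0, 1}`, and signs for the components can be
chosen such that the totals obey the bounds (`exists_signs_abs_sum_le`, `exists_balanced_flip`).
-/

/-! ### Edmonds' theorem on two disjoint branchings -/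

section Branchings

variable {V A : Type*} [DecidableEq V] (tail head : A → V)

/-- The arcs of `T` that enter the vertex set `W`. -/
def entering (T : Finset A) (W : Finset V) : Finset A :=
  T.filter fun a => head a ∈ W ∧ tail a ∉ W

variable {tail head}

theorem mem_entering {T : Finset A} {W : Finset V} {a : A} :
    a ∈ entering tail head T W ↔ a ∈ T ∧ head a ∈ W ∧ tail a ∉ W := by
  simp [entering]

/-- The number of entering arcs is a submodular set function. -/
theorem card_entering_inter_add_card_entering_union_le (T : Finset A) (W W' : Finset V) :
    (entering tail head T (W ∩ W')).card + (entering tail head T (W ∪ W')).card ≤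
      (entering tail head T W).card + (entering tail head T W').card := by
  simp only [entering, Finset.card_filter, ← Finset.sum_add_distrib]
  refine Finset.sum_le_sum fun a _ => ?_
  by_cases h1 : head a ∈ W <;> by_cases h2 : head a ∈ W' <;> by_cases h3 : tail a ∈ W <;>
    by_cases h4 : tail a ∈ W' <;> simp [h1, h2, h3, h4]

variable (tail head) in
/-- `B` is a branching with root set `R`: no arc of `B` enters a root, every other vertex is the
head of exactly one arc of `B`, and `B` has no directed cycle. Acyclicity is expressed by a rank
function that increases along the arcs of `B`. -/
structure IsBranching (B : Finset A) (R : Finset V) : Prop where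
  head_notMem : ∀ a ∈ B, head a ∉ R
  existsUnique : ∀ v ∉ R, ∃! a, a ∈ B ∧ head a = v
  exists_rank : ∃ h : V → ℕ, ∀ a ∈ B, h (tail a) < h (head a)

/-- If the heads of the arcs of `B` are exactly the vertices outside `R`, each once, then `B` has
`|V| - |R|` arcs. -/
theorem card_add_card_roots [Fintype V] {B : Finset A} {R : Finset V}
    (h1 : ∀ a ∈ B, head a ∉ R) (h2 : ∀ v ∉ R, ∃! a, a ∈ B ∧ head a = v) :
    B.card + R.card = Fintype.card V := by
  rw [← Finset.card_compl_add_card R]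
  congr 1
  refine Finset.card_bij (fun a _ => head a) (fun a ha => Finset.mem_compl.2 (h1 a ha))
    (fun a ha b hb hab => ?_) fun v hv => ?_
  · exact (h2 _ (h1 b hb)).unique ⟨ha, hab⟩ ⟨hb, rfl⟩
  · obtain ⟨a, ha, -⟩ := h2 v (Finset.mem_compl.1 hv)
    exact ⟨a, ha.1, ha.2⟩

variable [Fintype V]

variable [DecidableEq A]

/-- The exchange step in Lovász' proof of Edmonds' theorem: if `U` is not everything, some arc
leaving `U` can be deleted without destroying that every set disjoint from `R` is entered. -/
theorem exists_arc_erase_entering_nonempty {T : Finset A} {U R : Finset V} (hU : U ≠ Finset.univ)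
    (h1 : ∀ W : Finset V, W.Nonempty → Disjoint W U → (entering tail head T W).Nonempty)
    (h2 : ∀ W : Finset V, W.Nonempty → Disjoint W U → Disjoint W R →
      2 ≤ (entering tail head T W).card)
    (h3 : ∀ W : Finset V, W.Nonempty → Disjoint W R → (entering tail head T W).Nonempty) :
    ∃ a ∈ T, tail a ∈ U ∧ head a ∉ U ∧
      ∀ W : Finset V, W.Nonempty → Disjoint W R →
        (entering tail head (T.erase a) W).Nonempty := by
  -- it suffices that the arc enters no tight set
  suffices h : ∃ a ∈ T, tail a ∈ U ∧ head a ∉ U ∧ ∀ W : Finset V, Disjoint W R →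
      (entering tail head T W).card = 1 → a ∉ entering tail head T W by
    obtain ⟨a, haT, hat, hah, ha⟩ := h
    refine ⟨a, haT, hat, hah, fun W hW hWR => ?_⟩
    by_contra hne
    have hsub : entering tail head T W ⊆ {a} := by
      intro b hb
      by_contra hba
      rw [Finset.mem_singleton] at hba
      rw [mem_entering] at hb
      exact hne ⟨b, mem_entering.2 ⟨Finset.mem_erase.2 ⟨hba, hb.1⟩, hb.2⟩⟩
    have hcard : (entering tail head T W).card = 1 :=
      le_antisymm (Finset.card_le_card hsub) (h3 W hW hWR).card_pos
    obtain ⟨b, hb⟩ := h3 W hW hWR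
    have := Finset.mem_singleton.1 (hsub hb)
    exact ha W hWR hcard (this ▸ hb)
  by_cases hex : ∃ W : Finset V, Disjoint W R ∧ (entering tail head T W).card = 1 ∧ ¬ W ⊆ U
  · obtain ⟨W, hW, hmin⟩ := exists_minimal_of_wellFoundedLT
      (fun W : Finset V => Disjoint W R ∧ (entering tail head T W).card = 1 ∧ ¬ W ⊆ U) hex
    obtain ⟨hWR, hW1, hWU⟩ := hW
    have hne : (W \ U).Nonempty := by rwa [Finset.sdiff_nonempty]
    have h2' := h2 (W \ U) hne Finset.sdiff_disjoint (hWR.mono_left Finset.sdiff_subset)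
    obtain ⟨a, ha, ha'⟩ : ∃ a ∈ entering tail head T (W \ U), a ∉ entering tail head T W := by
      by_contra! hc
      have := Finset.card_le_card hc
      omega
    rw [mem_entering, Finset.mem_sdiff, Finset.mem_sdiff] at ha
    obtain ⟨haT, ⟨haW, haU⟩, hta⟩ := ha
    have htW : tail a ∈ W := by
      by_contra h
      exact ha' (mem_entering.2 ⟨haT, haW, h⟩)
    refine ⟨a, haT, by_contra fun h => hta ⟨htW, h⟩, haU, fun W' hW'R hW'1 haW' => ?_⟩
    rw [mem_entering] at haW'
    have hsm := card_entering_inter_add_card_entering_union_le (tail := tail) (head := head) T W W'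
    have hi : Disjoint (W ∩ W') R := hWR.mono_left Finset.inter_subset_left
    have hin := h3 (W ∩ W') ⟨head a, Finset.mem_inter.2 ⟨haW, haW'.2.1⟩⟩ hi
    have hun := h3 (W ∪ W') ⟨head a, Finset.mem_union_left _ haW⟩
      (Finset.disjoint_union_left.2 ⟨hWR, hW'R⟩)
    have hin' := hin.card_pos
    have hun' := hun.card_pos
    have hsub := hmin (y := W ∩ W') ⟨hi, by omega, fun h =>
      haU (h (Finset.mem_inter.2 ⟨haW, haW'.2.1⟩))⟩ Finset.inter_subset_left
    exact haW'.2.2 (Finset.mem_inter.1 (hsub htW)).2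
  · push Not at hex
    have hne : (Uᶜ).Nonempty := by
      rw [Finset.nonempty_iff_ne_empty, Ne, Finset.compl_eq_empty_iff]; exact hU
    obtain ⟨a, ha⟩ := h1 Uᶜ hne disjoint_compl_left
    rw [mem_entering] at ha
    simp only [Finset.mem_compl, not_not] at ha
    refine ⟨a, ha.1, ha.2.2, ha.2.1, fun W hWR hW1 haW => ha.2.1 (hex W hWR hW1 ?_)⟩
    exact (mem_entering.1 haW).2.1

/-- A branching with root set `U` can be chosen in `T` such that the remaining arcs still enter
every nonempty set disjoint from `R`. -/
theorem exists_isBranching_sdiff_entering_nonempty (R : Finset V) (T : Finset A) (U : Finset V)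
    (h1 : ∀ W : Finset V, W.Nonempty → Disjoint W U → (entering tail head T W).Nonempty)
    (h2 : ∀ W : Finset V, W.Nonempty → Disjoint W U → Disjoint W R →
      2 ≤ (entering tail head T W).card)
    (h3 : ∀ W : Finset V, W.Nonempty → Disjoint W R → (entering tail head T W).Nonempty) :
    ∃ B ⊆ T, IsBranching tail head B U ∧
      ∀ W : Finset V, W.Nonempty → Disjoint W R → (entering tail head (T \ B) W).Nonempty := by
  induction hn : (Uᶜ).card generalizing T U with
  | zero =>
    have hU : U = Finset.univ := by
      rwa [Finset.card_eq_zero, Finset.compl_eq_empty_iff] at hn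
    subst hU
    exact ⟨∅, Finset.empty_subset _, ⟨by simp, by simp, ⟨0, by simp⟩⟩, by simpa using h3⟩
  | succ n ih =>
    have hU : U ≠ Finset.univ := by
      rintro rfl
      simp at hn
    obtain ⟨a, haT, hat, hah, ha⟩ := exists_arc_erase_entering_nonempty hU h1 h2 h3
    have key : ∀ W : Finset V, Disjoint W (insert (head a) U) →
        Disjoint W U ∧ entering tail head (T.erase a) W = entering tail head T W := by
      intro W hW
      rw [Finset.disjoint_insert_right] at hW
      refine ⟨hW.2, ?_⟩
      ext b
      rw [mem_entering, mem_entering, Finset.mem_erase]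
      refine ⟨fun h => ⟨h.1.2, h.2⟩, fun h => ⟨⟨?_, h.1⟩, h.2⟩⟩
      rintro rfl
      exact hW.1 h.2.1
    have hn' : ((insert (head a) U)ᶜ).card = n := by
      rw [Finset.compl_insert, Finset.card_erase_of_mem (Finset.mem_compl.2 hah), hn]
      rfl
    obtain ⟨B, hBT, hB, hB'⟩ := ih (T.erase a) (insert (head a) U)
      (fun W hW hd => by rw [(key W hd).2]; exact h1 W hW (key W hd).1)
      (fun W hW hd hd' => by rw [(key W hd).2]; exact h2 W hW (key W hd).1 hd') ha hn'
    have haB : a ∉ B := fun h => (Finset.mem_erase.1 (hBT h)).1 rfl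
    refine ⟨insert a B, ?_, ⟨?_, ?_, ?_⟩, ?_⟩
    · exact Finset.insert_subset haT (hBT.trans (Finset.erase_subset _ _))
    · intro b hb
      rcases Finset.mem_insert.1 hb with rfl | hb
      · exact hah
      · exact fun h => hB.head_notMem b hb (Finset.mem_insert_of_mem h)
    · intro v hv
      by_cases hva : v = head a
      · subst hva
        refine ⟨a, ⟨Finset.mem_insert_self _ _, rfl⟩, ?_⟩
        rintro b ⟨hb, hb'⟩
        rcases Finset.mem_insert.1 hb with rfl | hb
        · rfl
        · exact absurd (hb' ▸ Finset.mem_insert_self _ _) (hB.head_notMem b hb)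
      · obtain ⟨b, ⟨hb, hb'⟩, hu⟩ := hB.existsUnique v (by simp [hva, hv])
        refine ⟨b, ⟨Finset.mem_insert_of_mem hb, hb'⟩, ?_⟩
        rintro d ⟨hd, hd'⟩
        rcases Finset.mem_insert.1 hd with rfl | hd
        · exact absurd hd'.symm hva
        · exact hu d ⟨hd, hd'⟩
    · obtain ⟨h, hh⟩ := hB.exists_rank
      -- the old roots get rank `0`, the new vertex rank `1`, and all others move up by one
      refine ⟨fun v => if v ∈ U then 0 else if v = head a then 1 else h v + 1, fun b hb => ?_⟩
      rcases Finset.mem_insert.1 hb with rfl | hb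
      · simp [hat, hah]
      · have hbr := hB.head_notMem b hb
        rw [Finset.mem_insert, not_or] at hbr
        have hlt := hh b hb
        simp only [hbr.1, hbr.2, if_false]
        split_ifs <;> omega
    · intro W hW hWR
      have : T \ insert a B = T.erase a \ B := by
        ext b
        simp only [Finset.mem_sdiff, Finset.mem_insert, Finset.mem_erase]
        tauto
      rw [this]
      exact hB' W hW hWR

/-- Edmonds' disjoint branchings theorem for two root sets. -/
theorem exists_disjoint_isBranching {T : Finset A} {R₁ R₂ : Finset V}
    (h1 : ∀ W : Finset V, W.Nonempty → Disjoint W R₁ → (entering tail head T W).Nonempty)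
    (h2 : ∀ W : Finset V, W.Nonempty → Disjoint W R₂ → (entering tail head T W).Nonempty)
    (h12 : ∀ W : Finset V, W.Nonempty → Disjoint W R₁ → Disjoint W R₂ →
      2 ≤ (entering tail head T W).card) :
    ∃ B₁ ⊆ T, ∃ B₂ ⊆ T, Disjoint B₁ B₂ ∧
      IsBranching tail head B₁ R₁ ∧ IsBranching tail head B₂ R₂ := by
  obtain ⟨B₁, hB₁, hb₁, h⟩ := exists_isBranching_sdiff_entering_nonempty R₂ T R₁ h1 h12 h2
  -- with every vertex a root, the condition on the remaining arcs is void
  have hvoid : ∀ W : Finset V, W.Nonempty → ¬ Disjoint W Finset.univ := fun W hW =>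
    hW.elim fun v hv => Finset.not_disjoint_iff.2 ⟨v, hv, Finset.mem_univ v⟩
  obtain ⟨B₂, hB₂, hb₂, -⟩ := exists_isBranching_sdiff_entering_nonempty Finset.univ (T \ B₁) R₂ h
    (fun W hW _ hd => absurd hd (hvoid W hW)) (fun W hW hd => absurd hd (hvoid W hW))
  exact ⟨B₁, hB₁, B₂, hB₂.trans Finset.sdiff_subset,
    (Finset.disjoint_sdiff).mono_right hB₂, hb₁, hb₂⟩

end Branchings

/-! ### Cycles in mixed graphs -/

namespace MixedGraph

variable {V E A : Type*} (G : MixedGraph V E A)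

theorem link_not_isDiag (x : E ⊕ A) : ¬ (G.link x).IsDiag := by
  cases x with
  | inl e => exact G.ends_not_isDiag e
  | inr a => simpa [link] using G.tail_ne_head a

variable {G}

/-- A member that joins `w` to a vertex of no larger rank covers `w`, if ranks increase along arcs. -/
theorem covers_of_link_eq {h : V → ℕ} {x : E ⊕ A}
    (hx : ∀ a, x = Sum.inr a → h (G.tail a) < h (G.head a)) {w w' : V}
    (hl : G.link x = s(w, w')) (hw : h w' ≤ h w) : G.Covers w x := by
  cases x with
  | inl e =>
    have hl : G.ends e = s(w, w') := hl
    simp [Covers, hl]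
  | inr a =>
    have hl : s(G.tail a, G.head a) = s(w, w') := hl
    have := hx a rfl
    rcases Sym2.eq_iff.1 hl with ⟨h1, h2⟩ | ⟨h1, h2⟩
    · rw [h1, h2] at this
      omega
    · exact h2

/-- If ranks increase along arcs, then there is no cycle: the two members of a cycle at a vertex of
maximal rank would both cover it. -/
theorem not_hasCycle_of_rank {F : Finset (E ⊕ A)}
    (hF : ∀ v : V, ∀ x ∈ F, ∀ y ∈ F, G.Covers v x → G.Covers v y → x = y) (h : V → ℕ)
    (hh : ∀ a, Sum.inr a ∈ F → h (G.tail a) < h (G.head a)) : ¬ G.HasCycle F := by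
  rintro ⟨n, v, x, hn, -, hx, hvn, hl⟩
  obtain ⟨i, hi, hmax⟩ := Finset.exists_max_image (Finset.range n) (fun i => h (v i)) ⟨0, by simpa⟩
  simp only [Finset.mem_range] at hi hmax
  have hmax' : ∀ j ≤ n, h (v j) ≤ h (v i) := by
    intro j hj
    rcases hj.lt_or_eq with hj | rfl
    · exact hmax j hj
    · rw [hvn]
      exact hmax 0 (by omega)
  obtain ⟨p, hp, hpi⟩ : ∃ p < n, v (p + 1) = v i := by
    rcases Nat.eq_zero_or_pos i with rfl | h0
    · exact ⟨n - 1, by omega, by rw [Nat.sub_add_cancel hn, hvn]⟩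
    · exact ⟨i - 1, by omega, by rw [Nat.sub_add_cancel h0]⟩
  have hci : G.Covers (v i) (x i) :=
    covers_of_link_eq (fun a ha => hh a (ha ▸ (hl i hi).1)) (hl i hi).2 (hmax' _ hi)
  have hcp : G.Covers (v i) (x p) := by
    refine covers_of_link_eq (w' := v p) (fun a ha => hh a (ha ▸ (hl p hp).1)) ?_ (hmax' _ hp.le)
    rw [(hl p hp).2, hpi, Sym2.eq_swap]
  have hpe : p = i := hx hp hi (hF _ _ (hl p hp).1 _ (hl i hi).1 hcp hci)
  subst hpe
  apply G.link_not_isDiag (x p)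
  rw [(hl p hp).2, hpi]
  exact rfl

/-- A nonempty vertex set in which every vertex is the head of a member of `F` with tail in the
set contains a directed cycle. -/
theorem hasCycle_of_forall_exists_arc {F : Finset (E ⊕ A)} {W : Finset V} (hW : W.Nonempty)
    (h : ∀ v ∈ W, ∃ a, Sum.inr a ∈ F ∧ G.head a = v ∧ G.tail a ∈ W) : G.HasCycle F := by
  obtain ⟨w, hw⟩ := hW
  have : Nonempty A := ⟨(h w hw).choose⟩
  choose! f hfF hfh hft using h
  -- follow the arcs backwards until a vertex repeats
  set p : V → V := fun v => G.tail (f v)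
  have hmem : ∀ v ∈ W, ∀ j, p^[j] v ∈ W := by
    intro v hv j
    induction j with
    | zero => exact hv
    | succ j ih =>
      rw [Function.iterate_succ_apply']
      exact hft _ ih
  obtain ⟨i, j, hij, he⟩ : ∃ i j : ℕ, i < j ∧ p^[i] w = p^[j] w := by
    obtain ⟨i, j, hne, he⟩ := Finite.exists_ne_map_eq_of_infinite
      (fun j : ℕ => (⟨p^[j] w, hmem w hw j⟩ : W))
    have he := Subtype.ext_iff.1 he
    rcases lt_or_gt_of_ne hne with hl | hl
    · exact ⟨i, j, hl, he⟩
    · exact ⟨j, i, hl, he.symm⟩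
  set v := p^[i] w with hv
  have hvW : v ∈ W := hmem w hw i
  have hper : Function.IsPeriodicPt p (j - i) v := by
    rw [Function.IsPeriodicPt, Function.IsFixedPt, hv, ← Function.iterate_add_apply,
      Nat.sub_add_cancel hij.le]
    exact he.symm
  have hpos : 0 < Function.minimalPeriod p v := hper.minimalPeriod_pos (by omega)
  have hinj : Set.InjOn (fun j => p^[j] v) (Set.Iio (Function.minimalPeriod p v)) :=
    Function.iterate_injOn_Iio_minimalPeriod
  refine ⟨Function.minimalPeriod p v, fun j => p^[j] v, fun j => Sum.inr (f (p^[j] v)), hpos,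
    hinj, ?_, ?_, fun i _ => ⟨hfF _ (hmem v hvW i), ?_⟩⟩
  · intro a ha b hb hab
    refine hinj ha hb ?_
    have := congrArg G.head (Sum.inr_injective hab)
    rwa [hfh _ (hmem v hvW a), hfh _ (hmem v hvW b)] at this
  · exact Function.iterate_minimalPeriod
  · change s(G.tail (f (p^[i] v)), G.head (f (p^[i] v))) = s(p^[i] v, p^[i + 1] v)
    rw [hfh _ (hmem v hvW i), Function.iterate_succ_apply', Sym2.eq_swap]

end MixedGraph

/-! ### Balancing vectors by signs -/

section Signs

variable {Q : Type*}

theorem exists_signs_sum_eq_zero_or_one (s : Finset Q) :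
    ∃ ε : Q → ℤ, (∀ q, ε q = 1 ∨ ε q = -1) ∧ (∑ q ∈ s, ε q = 0 ∨ ∑ q ∈ s, ε q = 1) := by
  classical
  induction s using Finset.induction_on with
  | empty => exact ⟨fun _ => 1, by simp, by simp⟩
  | insert a s ha ih =>
    obtain ⟨ε, hε, hs⟩ := ih
    have hcongr : ∀ c : ℤ, ∑ q ∈ s, Function.update ε a c q = ∑ q ∈ s, ε q := fun c =>
      Finset.sum_congr rfl fun q hq => Function.update_of_ne (by rintro rfl; exact ha hq) _ _
    have hsign : ∀ c : ℤ, c = 1 ∨ c = -1 → ∀ q,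
        Function.update ε a c q = 1 ∨ Function.update ε a c q = -1 := by
      intro c hc q
      by_cases hq : q = a
      · subst hq
        simpa using hc
      · simpa [hq] using hε q
    rcases hs with hs | hs
    · refine ⟨Function.update ε a 1, hsign _ (Or.inl rfl), Or.inr ?_⟩
      rw [Finset.sum_insert ha, hcongr, hs, Function.update_self]
      rfl
    · refine ⟨Function.update ε a (-1), hsign _ (Or.inr rfl), Or.inl ?_⟩
      rw [Finset.sum_insert ha, hcongr, hs, Function.update_self]
      rfl

/-- Balancing of vectors `(m q, u q)` with entries in `{-1, 0, 1}` by signs. Up to sign there are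
four nonzero vectors. Equal ones cancel in pairs, which leaves at most one vector of each kind, and
the signs of these can be chosen suitably. -/
theorem exists_signs_abs_sum_le [Fintype Q] (m u : Q → ℤ) (hm : ∀ q, |m q| ≤ 1)
    (hu : ∀ q, |u q| ≤ 1) :
    ∃ ε : Q → ℤ, (∀ q, ε q = 1 ∨ ε q = -1) ∧ |∑ q, ε q * m q| ≤ 1 ∧ |∑ q, ε q * u q| ≤ 2 ∧
      |∑ q, ε q * m q + ∑ q, ε q * u q| ≤ 2 := by
  have hm' : ∀ q, m q = -1 ∨ m q = 0 ∨ m q = 1 := fun q => by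
    have := abs_le.1 (hm q)
    omega
  have hu' : ∀ q, u q = -1 ∨ u q = 0 ∨ u q = 1 := fun q => by
    have := abs_le.1 (hu q)
    omega
  obtain ⟨e₁, he₁, hs₁⟩ := exists_signs_sum_eq_zero_or_one
    (Finset.univ.filter fun q => m q ≠ 0 ∧ u q = 0)
  obtain ⟨e₂, he₂, hs₂⟩ := exists_signs_sum_eq_zero_or_one
    (Finset.univ.filter fun q => m q = 0 ∧ u q ≠ 0)
  obtain ⟨e₃, he₃, hs₃⟩ := exists_signs_sum_eq_zero_or_one
    (Finset.univ.filter fun q => m q ≠ 0 ∧ u q = m q)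
  obtain ⟨e₄, he₄, hs₄⟩ := exists_signs_sum_eq_zero_or_one
    (Finset.univ.filter fun q => m q ≠ 0 ∧ u q = -m q)
  have key : ∀ d₁ d₂ d₃ d₄ : ℤ, (d₁ = 1 ∨ d₁ = -1) → (d₂ = 1 ∨ d₂ = -1) → (d₃ = 1 ∨ d₃ = -1) →
      (d₄ = 1 ∨ d₄ = -1) → ∃ ε : Q → ℤ, (∀ q, ε q = 1 ∨ ε q = -1) ∧
      ∑ q, ε q * m q = d₁ * ∑ q with m q ≠ 0 ∧ u q = 0, e₁ q +
        d₃ * ∑ q with m q ≠ 0 ∧ u q = m q, e₃ q + d₄ * ∑ q with m q ≠ 0 ∧ u q = -m q, e₄ q ∧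
      ∑ q, ε q * u q = d₂ * ∑ q with m q = 0 ∧ u q ≠ 0, e₂ q +
        d₃ * ∑ q with m q ≠ 0 ∧ u q = m q, e₃ q - d₄ * ∑ q with m q ≠ 0 ∧ u q = -m q, e₄ q := by
    intro d₁ d₂ d₃ d₄ hd₁ hd₂ hd₃ hd₄
    refine ⟨fun q => if m q = 0 then (if u q = 0 then 1 else d₂ * e₂ q * u q)
      else if u q = 0 then d₁ * e₁ q * m q else if u q = m q then d₃ * e₃ q * m q
      else d₄ * e₄ q * m q, fun q => ?_, ?_, ?_⟩
    · rcases hm' q with h | h | h <;> rcases hu' q with h' | h' | h' <;>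
        rcases he₁ q with h₁ | h₁ <;> rcases he₂ q with h₂ | h₂ <;> rcases he₃ q with h₃ | h₃ <;>
        rcases he₄ q with h₄ | h₄ <;> simp [h, h', h₁, h₂, h₃, h₄] <;> omega
    · simp only [Finset.sum_filter, Finset.mul_sum, ← Finset.sum_add_distrib]
      refine Finset.sum_congr rfl fun q _ => ?_
      rcases hm' q with h | h | h <;> rcases hu' q with h' | h' | h' <;> simp [h, h']
    · simp only [Finset.sum_filter, Finset.mul_sum, ← Finset.sum_add_distrib,
        ← Finset.sum_sub_distrib]
      refine Finset.sum_congr rfl fun q _ => ?_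
      rcases hm' q with h | h | h <;> rcases hu' q with h' | h' | h' <;> simp [h, h']
  have table : ∀ a ∈ ({0, 1} : Finset ℤ), ∀ b ∈ ({0, 1} : Finset ℤ), ∀ c ∈ ({0, 1} : Finset ℤ),
      ∀ d ∈ ({0, 1} : Finset ℤ), ∃ d₁ ∈ ({1, -1} : Finset ℤ), ∃ d₂ ∈ ({1, -1} : Finset ℤ),
      ∃ d₃ ∈ ({1, -1} : Finset ℤ), ∃ d₄ ∈ ({1, -1} : Finset ℤ),
      |d₁ * a + d₃ * c + d₄ * d| ≤ 1 ∧ |d₂ * b + d₃ * c - d₄ * d| ≤ 2 ∧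
      |(d₁ * a + d₃ * c + d₄ * d) + (d₂ * b + d₃ * c - d₄ * d)| ≤ 2 := by
    decide
  obtain ⟨d₁, hd₁, d₂, hd₂, d₃, hd₃, d₄, hd₄, hd⟩ := table _ (by simpa using hs₁) _
    (by simpa using hs₂) _ (by simpa using hs₃) _ (by simpa using hs₄)
  obtain ⟨ε, hε, h1, h2⟩ := key d₁ d₂ d₃ d₄ (by simpa using hd₁) (by simpa using hd₂)
    (by simpa using hd₃) (by simpa using hd₄)
  refine ⟨ε, hε, ?_⟩
  rw [h1, h2]
  exact hd

end Signs

/-! ### Alternating values on the components of a graph -/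

section Components

open scoped Classical in
/-- If every edge of a graph has an end in `P`, then a component has at most one vertex more than the
sum of the degrees of its vertices in `P`: that sum bounds the number of its edges. -/
theorem SimpleGraph.ConnectedComponent.card_le_one_add_sum_degree {X : Type*} [Fintype X]
    {Γ : SimpleGraph X} (C : Γ.ConnectedComponent) (P : X → Prop)
    (hP : ∀ x y, Γ.Adj x y → P x ∨ P y) :
    (Finset.univ.filter fun x => Γ.connectedComponentMk x = C).card ≤
      1 + ∑ x with Γ.connectedComponentMk x = C, if P x then Γ.degree x else 0 := by
  have h1 := C.connected_toSimpleGraph.card_vert_le_card_edgeSet_add_one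
  have h2 : Nat.card C = (Finset.univ.filter fun x => Γ.connectedComponentMk x = C).card := by
    rw [← Fintype.card_subtype, ← Nat.card_eq_fintype_card]
    rfl
  have h3 : Nat.card C.toSimpleGraph.edgeSet =
      (C.toSimpleGraph.edgeFinset.image (Sym2.map Subtype.val)).card := by
    rw [Finset.card_image_of_injective _ (Sym2.map.injective Subtype.val_injective),
      Nat.card_eq_fintype_card, SimpleGraph.edgeFinset_card]
  have h4 : C.toSimpleGraph.edgeFinset.image (Sym2.map Subtype.val) ⊆
      (Finset.univ.filter fun x => Γ.connectedComponentMk x = C ∧ P x).biUnion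
        fun x => Γ.incidenceFinset x := by
    intro z hz
    obtain ⟨w, hw, rfl⟩ := Finset.mem_image.1 hz
    rw [SimpleGraph.mem_edgeFinset] at hw
    induction w using Sym2.ind with
    | _ x y =>
      have hadj : Γ.Adj x.1 y.1 := hw
      have hmem : ∀ t : C, Γ.connectedComponentMk t.1 = C := fun t => t.2
      simp only [Finset.mem_biUnion, Finset.mem_filter, Finset.mem_univ, true_and, Sym2.map_mk,
        SimpleGraph.mem_incidenceFinset]
      rcases hP _ _ hadj with h | h
      · exact ⟨x, ⟨hmem x, h⟩, hadj, Sym2.mem_mk_left _ _⟩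
      · exact ⟨y, ⟨hmem y, h⟩, hadj, Sym2.mem_mk_right _ _⟩
  have h5 := (Finset.card_le_card h4).trans Finset.card_biUnion_le
  simp only [SimpleGraph.card_incidenceFinset_eq_degree] at h5
  rw [← Finset.filter_filter, Finset.sum_filter] at h5
  omega

open scoped Classical in
/-- If nonzero values alternate along the edges of a graph of maximum degree two, then their sum over a
component is at least `-1`, as the component is a path or an even cycle. -/
theorem neg_one_le_sum_of_degree_le_two {X : Type*} [Fintype X] {Γ : SimpleGraph X} (u : X → ℤ)
    (hu : ∀ x, u x = -1 ∨ u x = 0 ∨ u x = 1) (halt : ∀ x y, Γ.Adj x y → u y = -u x ∧ u x ≠ 0)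
    (hdeg : ∀ x, Γ.degree x ≤ 2) (C : Γ.ConnectedComponent) :
    -1 ≤ ∑ x with Γ.connectedComponentMk x = C, u x := by
  have h := C.card_le_one_add_sum_degree (fun x => u x = 1) fun x y hxy => by
    have := halt x y hxy
    have := hu x
    omega
  rw [Finset.card_eq_sum_ones] at h
  have h' : ∑ x with Γ.connectedComponentMk x = C, (1 : ℤ) ≤
      1 + ∑ x with Γ.connectedComponentMk x = C, if u x = 1 then (Γ.degree x : ℤ) else 0 := by
    exact_mod_cast h
  have hle : ∑ x with Γ.connectedComponentMk x = C, (if u x = 1 then (Γ.degree x : ℤ) else 0) ≤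
      ∑ x with Γ.connectedComponentMk x = C, (1 + u x) := by
    refine Finset.sum_le_sum fun x _ => ?_
    have h1 := hu x
    have h2 := hdeg x
    split_ifs <;> omega
  rw [Finset.sum_add_distrib] at hle
  linarith

open scoped Classical in
/-- Let the values `-σ` on `E` and `ρ` on `V` alternate along the edges of a graph in which elements
of `E` have degree at most two and a vertex has, apart from its partner under the involution `π`,
at most one neighbour. Then the sum of `σ` over a component is at least `-1`: contracting the
vertices leaves a path or cycle on which the values of `σ` alternate. -/
theorem neg_one_le_sum_left_of_degree_le {E V : Type*} [Fintype E] [Fintype V]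
    {Γ : SimpleGraph (E ⊕ V)} (σ : E → ℤ) (ρ : V → ℤ) (π : V → V)
    (hσ : ∀ e, σ e = -1 ∨ σ e = 0 ∨ σ e = 1) (hρ : ∀ v, ρ v = -1 ∨ ρ v = 0 ∨ ρ v = 1)
    (halt : ∀ x y, Γ.Adj x y → Sum.elim (fun e => -σ e) ρ y = -Sum.elim (fun e => -σ e) ρ x ∧
      Sum.elim (fun e => -σ e) ρ x ≠ 0)
    (hE : ∀ e, Γ.degree (Sum.inl e) ≤ 2)
    (hV : ∀ v, Γ.degree (Sum.inr v) ≤ 1 + if π v = v then 0 else 1)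
    (hπ : Function.Involutive π) (hπΓ : ∀ v, π v ≠ v → Γ.Adj (Sum.inr v) (Sum.inr (π v)))
    (C : Γ.ConnectedComponent) :
    -1 ≤ ∑ e with Γ.connectedComponentMk (Sum.inl e) = C, σ e := by
  have h := C.card_le_one_add_sum_degree (fun x => Sum.elim (fun e => -σ e) ρ x = -1)
    fun x y hxy => by
      have := halt x y hxy
      have : ∀ x, Sum.elim (fun e => -σ e) ρ x = -1 ∨ Sum.elim (fun e => -σ e) ρ x = 0 ∨
          Sum.elim (fun e => -σ e) ρ x = 1 := by
        rintro (e | v)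
        · have := hσ e
          simp only [Sum.elim_inl]
          omega
        · exact hρ v
      have := this x
      omega
  rw [Finset.card_eq_sum_ones, Finset.sum_filter, Finset.sum_filter, Fintype.sum_sum_type,
    Fintype.sum_sum_type] at h
  simp only [Sum.elim_inl, Sum.elim_inr] at h
  simp only [← Finset.sum_filter] at h
  have h' : (∑ e with Γ.connectedComponentMk (Sum.inl e) = C, (1 : ℤ)) +
      ∑ v with Γ.connectedComponentMk (Sum.inr v) = C, (1 : ℤ) ≤
      1 + (∑ e with Γ.connectedComponentMk (Sum.inl e) = C,
          (if -σ e = -1 then (Γ.degree (Sum.inl e) : ℤ) else 0) +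
        ∑ v with Γ.connectedComponentMk (Sum.inr v) = C,
          (if ρ v = -1 then (Γ.degree (Sum.inr v) : ℤ) else 0)) := by
    simp only [Finset.sum_filter] at h ⊢
    exact_mod_cast h
  have hEle : ∑ e with Γ.connectedComponentMk (Sum.inl e) = C,
      (if -σ e = -1 then (Γ.degree (Sum.inl e) : ℤ) else 0) ≤
      ∑ e with Γ.connectedComponentMk (Sum.inl e) = C, (1 + σ e) := by
    refine Finset.sum_le_sum fun e _ => ?_
    have h1 := hσ e
    have h2 := hE e
    split_ifs <;> omega
  have hVle : ∑ v with Γ.connectedComponentMk (Sum.inr v) = C,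
      (if ρ v = -1 then (Γ.degree (Sum.inr v) : ℤ) else 0) ≤
      ∑ v with Γ.connectedComponentMk (Sum.inr v) = C, (if ρ v = -1 then (1 : ℤ) else 0) +
      ∑ v with Γ.connectedComponentMk (Sum.inr v) = C,
        (if ρ v = -1 ∧ π v ≠ v then (1 : ℤ) else 0) := by
    rw [← Finset.sum_add_distrib]
    refine Finset.sum_le_sum fun v _ => ?_
    have h2 := hV v
    by_cases h3 : π v = v <;> by_cases h4 : ρ v = -1 <;> simp [h3, h4] at h2 ⊢ <;> omega
  -- the partner of a vertex of value `-1` has value `1`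
  have hπle : ∑ v with Γ.connectedComponentMk (Sum.inr v) = C,
        (if ρ v = -1 ∧ π v ≠ v then (1 : ℤ) else 0) ≤
      ∑ v with Γ.connectedComponentMk (Sum.inr v) = C, (if ρ v = 1 then (1 : ℤ) else 0) := by
    rw [Finset.sum_filter, Finset.sum_filter, ← Equiv.sum_comp hπ.toPerm]
    refine Finset.sum_le_sum fun v _ => ?_
    simp only [Function.Involutive.coe_toPerm, hπ v]
    by_cases hv : π v = v
    · simp only [hv, ne_eq, not_true_eq_false, and_false, if_false]
      split_ifs <;> simp
    · have hadj := hπΓ v hv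
      have h1 := (halt _ _ hadj).1
      simp only [Sum.elim_inr] at h1
      rw [SimpleGraph.ConnectedComponent.sound hadj.symm.reachable, h1]
      split_ifs <;> omega
  have hone : ∑ v with Γ.connectedComponentMk (Sum.inr v) = C, (if ρ v = -1 then (1 : ℤ) else 0) +
      ∑ v with Γ.connectedComponentMk (Sum.inr v) = C, (if ρ v = 1 then (1 : ℤ) else 0) ≤
      ∑ v with Γ.connectedComponentMk (Sum.inr v) = C, (1 : ℤ) := by
    rw [← Finset.sum_add_distrib]
    refine Finset.sum_le_sum fun v _ => ?_
    split_ifs <;> omega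
  rw [Finset.sum_add_distrib] at hEle
  linarith

end Components

/-! ### Flipping colours along dependences -/

section Flips

variable {V E : Type*} (ends : E → Sym2 V) (σ : E → ℤ) (ρ : V → ℤ) (π : V → V)

/-- The graph of dependences between the colours `σ` of edges and the colours `ρ` of vertices:
coloured edges with a common endpoint, a coloured edge and a coloured endpoint of it, and a vertex
and its partner under the involution `π`. -/
def dependenceGraph (hπ : Function.Involutive π) : SimpleGraph (E ⊕ V) where
  Adj
    | Sum.inl e, Sum.inl e' => e ≠ e' ∧ σ e ≠ 0 ∧ σ e' ≠ 0 ∧ ∃ v, v ∈ ends e ∧ v ∈ ends e'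
    | Sum.inl e, Sum.inr v => σ e ≠ 0 ∧ ρ v ≠ 0 ∧ v ∈ ends e
    | Sum.inr v, Sum.inl e => σ e ≠ 0 ∧ ρ v ≠ 0 ∧ v ∈ ends e
    | Sum.inr v, Sum.inr w => w = π v ∧ w ≠ v
  symm := ⟨by
    rintro (e | v) (e' | w) h
    · exact ⟨h.1.symm, h.2.2.1, h.2.1, h.2.2.2.imp fun v hv => hv.symm⟩
    · exact h
    · exact h
    · exact ⟨by rw [h.1, hπ], h.2.symm⟩⟩
  loopless := ⟨by
    rintro (e | v) h
    · exact h.1 rfl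
    · exact h.2 rfl⟩

variable {ends σ ρ π}

open scoped Classical in
theorem degree_dependenceGraph_inl_le [Fintype E] [Fintype V] (hπ : Function.Involutive π)
    (hEE : ∀ e e' v, e ≠ e' → σ e ≠ 0 → σ e' ≠ 0 → v ∈ ends e → v ∈ ends e' →
      σ e' = -σ e ∧ ρ v = 0) (e : E) :
    (dependenceGraph ends σ ρ π hπ).degree (Sum.inl e) ≤ 2 := by
  rw [← SimpleGraph.card_neighborFinset_eq_degree]
  have h2 : (ends e).toFinset.card ≤ 2 := by
    rw [Sym2.card_toFinset]
    split_ifs <;> omega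
  refine le_trans ?_ h2
  -- each endpoint of `e` accounts for at most one neighbour
  refine Finset.card_le_card_of_forall_subsingleton
    (fun y v => Sum.elim (fun e' => v ∈ ends e') (fun w => w = v) y) ?_ ?_
  · rintro (e' | w) hy
    · rw [SimpleGraph.mem_neighborFinset] at hy
      obtain ⟨-, -, -, v, hv, hv'⟩ := hy
      exact ⟨v, Sym2.mem_toFinset.2 hv, hv'⟩
    · rw [SimpleGraph.mem_neighborFinset] at hy
      exact ⟨w, Sym2.mem_toFinset.2 hy.2.2, rfl⟩
  · intro v hv
    rw [Sym2.mem_toFinset] at hv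
    rintro (e' | w) ⟨hy, hyv⟩ (e'' | w') ⟨hz, hzv⟩ <;>
      rw [SimpleGraph.mem_neighborFinset] at hy hz
    · by_contra hne
      have hne : e' ≠ e'' := fun h => hne (h ▸ rfl)
      have h1 := (hEE e e' v hy.1 hy.2.1 hy.2.2.1 hv hyv).1
      have h2 := (hEE e e'' v hz.1 hz.2.1 hz.2.2.1 hv hzv).1
      have h3 := (hEE e' e'' v hne hy.2.2.1 hz.2.2.1 hyv hzv).1
      have := hy.2.1
      omega
    · have hzv : w' = v := hzv
      subst hzv
      exact absurd (hEE e e' w' hy.1 hy.2.1 hy.2.2.1 hv hyv).2 hz.2.1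
    · have hyv : w = v := hyv
      subst hyv
      exact absurd (hEE e e'' w hz.1 hz.2.1 hz.2.2.1 hv hzv).2 hy.2.1
    · have hyv : w = v := hyv
      have hzv : w' = v := hzv
      rw [hyv, hzv]

open scoped Classical in
theorem degree_dependenceGraph_inr_le [Fintype E] [Fintype V] (hπ : Function.Involutive π)
    (hEE : ∀ e e' v, e ≠ e' → σ e ≠ 0 → σ e' ≠ 0 → v ∈ ends e → v ∈ ends e' →
      σ e' = -σ e ∧ ρ v = 0) (v : V) :
    (dependenceGraph ends σ ρ π hπ).degree (Sum.inr v) ≤ 1 + if π v = v then 0 else 1 := by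
  rw [← SimpleGraph.card_neighborFinset_eq_degree,
    ← Finset.card_toLeft_add_card_toRight]
  refine add_le_add ?_ ?_
  · rw [Finset.card_le_one]
    intro e he e' he'
    rw [Finset.mem_toLeft, SimpleGraph.mem_neighborFinset] at he he'
    by_contra hne
    exact he.2.1 (hEE e e' v hne he.1 he'.1 he.2.2 he'.2.2).2
  · split_ifs with h
    · rw [Nat.le_zero, Finset.card_eq_zero, Finset.eq_empty_iff_forall_notMem]
      intro w hw
      rw [Finset.mem_toRight, SimpleGraph.mem_neighborFinset] at hw
      exact hw.2 (hw.1.trans h)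
    · rw [Finset.card_le_one]
      intro w hw w' hw'
      rw [Finset.mem_toRight, SimpleGraph.mem_neighborFinset] at hw hw'
      rw [hw.1, hw'.1]

/-- Colours of edges and vertices can be flipped consistently along all dependences such that the
resulting colour classes are almost balanced. -/
theorem exists_balanced_flip [Fintype E] [Fintype V] (hπ : Function.Involutive π)
    (hσ : ∀ e, σ e = -1 ∨ σ e = 0 ∨ σ e = 1) (hρ : ∀ v, ρ v = -1 ∨ ρ v = 0 ∨ ρ v = 1)
    (hEE : ∀ e e' v, e ≠ e' → σ e ≠ 0 → σ e' ≠ 0 → v ∈ ends e → v ∈ ends e' →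
      σ e' = -σ e ∧ ρ v = 0)
    (hEV : ∀ e v, v ∈ ends e → σ e ≠ 0 → ρ v ≠ 0 → ρ v = σ e)
    (hπρ : ∀ v, π v ≠ v → ρ (π v) = -ρ v ∧ ρ v ≠ 0) :
    ∃ (ε : E → ℤ) (δ : V → ℤ), (∀ e, ε e = 1 ∨ ε e = -1) ∧ (∀ v, δ v = 1 ∨ δ v = -1) ∧
      (∀ e e' v, e ≠ e' → σ e ≠ 0 → σ e' ≠ 0 → v ∈ ends e → v ∈ ends e' → ε e = ε e') ∧
      (∀ e v, v ∈ ends e → σ e ≠ 0 → ρ v ≠ 0 → ε e = δ v) ∧ (∀ v, δ (π v) = δ v) ∧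
      |∑ e, ε e * σ e| ≤ 1 ∧ |∑ v, δ v * ρ v| ≤ 2 ∧
      |∑ e, ε e * σ e - ∑ v, δ v * ρ v| ≤ 2 := by
  classical
  set Γ := dependenceGraph ends σ ρ π hπ
  set u : E ⊕ V → ℤ := Sum.elim (fun e => -σ e) ρ with hu_def
  have hu : ∀ x, u x = -1 ∨ u x = 0 ∨ u x = 1 := by
    rintro (e | v)
    · have := hσ e
      simp only [hu_def, Sum.elim_inl]
      omega
    · exact hρ v
  have halt : ∀ x y, Γ.Adj x y → u y = -u x ∧ u x ≠ 0 := by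
    rintro (e | v) (e' | w) h
    · obtain ⟨hne, h1, h2, v, hv, hv'⟩ := h
      have := (hEE e e' v hne h1 h2 hv hv').1
      simp only [hu_def, Sum.elim_inl]
      omega
    · have := hEV e w h.2.2 h.1 h.2.1
      have := h.1
      simp only [hu_def, Sum.elim_inl, Sum.elim_inr]
      omega
    · have := hEV e' v h.2.2 h.1 h.2.1
      have := h.1
      simp only [hu_def, Sum.elim_inl, Sum.elim_inr]
      omega
    · obtain ⟨h1, h2⟩ := h
      subst h1
      exact hπρ v h2
  have hE : ∀ e, Γ.degree (Sum.inl e) ≤ 2 := degree_dependenceGraph_inl_le hπ hEE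
  have hV : ∀ v, Γ.degree (Sum.inr v) ≤ 1 + if π v = v then 0 else 1 :=
    degree_dependenceGraph_inr_le hπ hEE
  have hdeg : ∀ x, Γ.degree x ≤ 2 := by
    rintro (e | v)
    · exact hE e
    · refine (hV v).trans ?_
      split_ifs <;> omega
  have hπΓ : ∀ v, π v ≠ v → Γ.Adj (Sum.inr v) (Sum.inr (π v)) := fun v hv => ⟨rfl, hv⟩
  have hm : ∀ C : Γ.ConnectedComponent,
      |∑ e with Γ.connectedComponentMk (Sum.inl e) = C, σ e| ≤ 1 := by
    intro C
    have h1 := neg_one_le_sum_left_of_degree_le σ ρ π hσ hρ halt hE hV hπ hπΓ C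
    have h2 := neg_one_le_sum_left_of_degree_le (fun e => -σ e) (fun v => -ρ v) π
      (fun e => by have := hσ e; omega) (fun v => by have := hρ v; omega) (fun x y hxy => by
        have h := halt x y hxy
        have hneg : ∀ x, Sum.elim (fun e => - -σ e) (fun v => -ρ v) x = -u x := by
          rintro (e | v) <;> rfl
        rw [hneg, hneg]
        omega) hE hV hπ hπΓ C
    rw [Finset.sum_neg_distrib] at h2
    rw [abs_le]
    constructor <;> linarith
  have hu' : ∀ C : Γ.ConnectedComponent,
      |∑ x with Γ.connectedComponentMk x = C, u x| ≤ 1 := by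
    intro C
    have h1 := neg_one_le_sum_of_degree_le_two u hu halt hdeg C
    have h2 := neg_one_le_sum_of_degree_le_two (fun x => -u x)
      (fun x => by have := hu x; omega) (fun x y hxy => by have := halt x y hxy; omega) hdeg C
    rw [Finset.sum_neg_distrib] at h2
    rw [abs_le]
    constructor <;> linarith
  obtain ⟨τ, hτ, hb1, hb2, hb3⟩ := exists_signs_abs_sum_le _ _ hm hu'
  have hsum1 : ∑ C, τ C * ∑ e with Γ.connectedComponentMk (Sum.inl e) = C, σ e =
      ∑ e, τ (Γ.connectedComponentMk (Sum.inl e)) * σ e := by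
    rw [← Finset.sum_fiberwise Finset.univ (fun e => Γ.connectedComponentMk (Sum.inl e))]
    refine Finset.sum_congr rfl fun C _ => ?_
    rw [Finset.mul_sum]
    refine Finset.sum_congr rfl fun e he => ?_
    rw [(Finset.mem_filter.1 he).2]
  have hsum2 : ∑ C, τ C * ∑ x with Γ.connectedComponentMk x = C, u x =
      -∑ e, τ (Γ.connectedComponentMk (Sum.inl e)) * σ e +
        ∑ v, τ (Γ.connectedComponentMk (Sum.inr v)) * ρ v := by
    have : ∑ C, τ C * ∑ x with Γ.connectedComponentMk x = C, u x =
        ∑ x, τ (Γ.connectedComponentMk x) * u x := by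
      rw [← Finset.sum_fiberwise Finset.univ (fun x => Γ.connectedComponentMk x)]
      refine Finset.sum_congr rfl fun C _ => ?_
      rw [Finset.mul_sum]
      refine Finset.sum_congr rfl fun e he => ?_
      rw [(Finset.mem_filter.1 he).2]
    rw [this, Fintype.sum_sum_type]
    simp [hu_def]
  rw [hsum1] at hb1 hb3
  rw [hsum2] at hb2 hb3
  refine ⟨fun e => τ (Γ.connectedComponentMk (Sum.inl e)),
    fun v => τ (Γ.connectedComponentMk (Sum.inr v)), fun e => hτ _, fun v => hτ _, ?_, ?_, ?_,
    hb1, by simpa using hb3, ?_⟩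
  · intro e e' v hne h1 h2 hv hv'
    have hadj : Γ.Adj (Sum.inl e) (Sum.inl e') := ⟨hne, h1, h2, v, hv, hv'⟩
    exact congrArg τ (SimpleGraph.ConnectedComponent.sound hadj.reachable)
  · intro e v hv h1 h2
    have hadj : Γ.Adj (Sum.inl e) (Sum.inr v) := ⟨h1, h2, hv⟩
    exact congrArg τ (SimpleGraph.ConnectedComponent.sound hadj.reachable)
  · intro v
    by_cases hv : π v = v
    · simp only [hv]
    · exact congrArg τ (SimpleGraph.ConnectedComponent.sound (hπΓ v hv).symm.reachable)
  · rw [← abs_neg, neg_sub]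
    rwa [neg_add_eq_sub] at hb2

end Flips

/-! ### Roots, source sets and branchings of matching forests -/

namespace MixedGraph

variable {V E A : Type*} (G : MixedGraph V E A)

open scoped Classical in
/-- The roots of `F`: the vertices that are not the head of an arc of `F`. Endpoints of undirected
edges in `F` may be roots. -/
noncomputable def roots [Fintype V] (F : Finset (E ⊕ A)) : Finset V :=
  Finset.univ.filter fun v => ∀ a, Sum.inr a ∈ F → G.head a ≠ v

/-- A nonempty vertex set that no arc of `F` enters. -/
def IsSource (F : Finset (E ⊕ A)) (W : Finset V) : Prop :=
  W.Nonempty ∧ ∀ a, Sum.inr a ∈ F → G.head a ∈ W → G.tail a ∈ W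

variable {G}

theorem mem_roots [Fintype V] {F : Finset (E ⊕ A)} {v : V} :
    v ∈ G.roots F ↔ ∀ a, Sum.inr a ∈ F → G.head a ≠ v := by
  simp [roots]

theorem IsSource.mono {F F' : Finset (E ⊕ A)} {W : Finset V} (h : G.IsSource F' W)
    (hF : F ⊆ F') : G.IsSource F W :=
  ⟨h.1, fun a ha => h.2 a (hF ha)⟩

theorem IsSource.exists_mem_roots [Fintype V] {F : Finset (E ⊕ A)} {W : Finset V}
    (h : G.IsSource F W) (hF : ¬ G.HasCycle F) : ∃ v ∈ W, v ∈ G.roots F := by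
  by_contra! hc
  refine hF (hasCycle_of_forall_exists_arc h.1 fun v hv => ?_)
  have := hc v hv
  rw [mem_roots] at this
  push Not at this
  obtain ⟨a, ha, rfl⟩ := this
  exact ⟨a, ha, rfl, h.2 a ha hv⟩

theorem eq_of_minimal_isSource [DecidableEq V] {F : Finset (E ⊕ A)} {K K' : Finset V}
    (hK : Minimal (G.IsSource F) K) (hK' : Minimal (G.IsSource F) K') {v : V} (hv : v ∈ K)
    (hv' : v ∈ K') : K = K' := by
  have h : G.IsSource F (K ∩ K') := by
    refine ⟨⟨v, Finset.mem_inter.2 ⟨hv, hv'⟩⟩, fun a ha hh => ?_⟩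
    rw [Finset.mem_inter] at hh ⊢
    exact ⟨hK.1.2 a ha hh.1, hK'.1.2 a ha hh.2⟩
  exact Finset.Subset.antisymm
    ((hK.2 h Finset.inter_subset_left).trans Finset.inter_subset_right)
    ((hK'.2 h Finset.inter_subset_right).trans Finset.inter_subset_left)

/-- Each minimal source set without a common root of `F₁` and `F₂` contains a root of `F₁` and a
root of `F₂`, and these are swapped by the involution. -/
theorem exists_involutive_forall_isSource [Fintype V] [DecidableEq (E ⊕ A)]
    {F₁ F₂ : Finset (E ⊕ A)} (h₁ : ¬ G.HasCycle F₁) (h₂ : ¬ G.HasCycle F₂) :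
    ∃ π : V → V, Function.Involutive π ∧
      (∀ v, π v ≠ v → v ∈ G.roots F₁ ∧ v ∉ G.roots F₂ ∧ π v ∈ G.roots F₂ ∧ π v ∉ G.roots F₁ ∨
        v ∈ G.roots F₂ ∧ v ∉ G.roots F₁ ∧ π v ∈ G.roots F₁ ∧ π v ∉ G.roots F₂) ∧
      ∀ W, G.IsSource (F₁ ∪ F₂) W →
        (∃ v ∈ W, v ∈ G.roots F₁ ∧ v ∈ G.roots F₂) ∨ ∃ v ∈ W, π v ∈ W ∧ π v ≠ v := by
  classical
  rcases isEmpty_or_nonempty V with hV | hV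
  · exact ⟨id, fun _ => rfl, fun v => isEmptyElim v, fun W hW => isEmptyElim hW.1.choose⟩
  set 𝒦 : Finset V → Prop := fun K => Minimal (G.IsSource (F₁ ∪ F₂)) K ∧
    ∀ v ∈ K, v ∈ G.roots F₁ → v ∉ G.roots F₂
  have ha : ∀ K, 𝒦 K → ∃ v ∈ K, v ∈ G.roots F₁ := fun K hK =>
    (hK.1.1.mono Finset.subset_union_left).exists_mem_roots h₁
  have hb : ∀ K, 𝒦 K → ∃ v ∈ K, v ∈ G.roots F₂ := fun K hK =>
    (hK.1.1.mono Finset.subset_union_right).exists_mem_roots h₂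
  choose! a haK haR using ha
  choose! b hbK hbR using hb
  have hab : ∀ K, 𝒦 K → a K ≠ b K := fun K hK h =>
    hK.2 _ (haK K hK) (haR K hK) (h ▸ hbR K hK)
  obtain ⟨π, hπ, hπ'⟩ : ∃ π : V → V, (∀ K, 𝒦 K → ∀ v ∈ K, π v = Equiv.swap (a K) (b K) v) ∧
      ∀ v, (∀ K, 𝒦 K → v ∉ K) → π v = v := by
    refine ⟨fun v => if h : ∃ K, 𝒦 K ∧ v ∈ K then Equiv.swap (a h.choose) (b h.choose) v else v,
      fun K hK v hv => ?_, fun v hv => ?_⟩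
    · have h : ∃ K, 𝒦 K ∧ v ∈ K := ⟨K, hK, hv⟩
      have hKe : h.choose = K := eq_of_minimal_isSource h.choose_spec.1.1 hK.1 h.choose_spec.2 hv
      simp only [dif_pos h, hKe]
    · refine dif_neg ?_
      rintro ⟨K, hK, hvK⟩
      exact hv K hK hvK
  have hmem : ∀ K, 𝒦 K → ∀ v ∈ K, π v ∈ K := by
    intro K hK v hv
    rw [hπ K hK v hv, Equiv.swap_apply_def]
    split_ifs
    exacts [hbK K hK, haK K hK, hv]
  refine ⟨π, fun v => ?_, fun v hv => ?_, fun W hW => ?_⟩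
  · by_cases h : ∃ K, 𝒦 K ∧ v ∈ K
    · obtain ⟨K, hK, hv⟩ := h
      rw [hπ K hK _ (hmem K hK v hv), hπ K hK v hv, Equiv.swap_apply_self]
    · push Not at h
      rw [hπ' v h, hπ' v h]
  · obtain ⟨K, hK, hvK⟩ : ∃ K, 𝒦 K ∧ v ∈ K := by
      by_contra! h
      exact hv (hπ' v h)
    have hb' : b K ∉ G.roots F₁ := fun h => hK.2 _ (hbK K hK) h (hbR K hK)
    have ha' : a K ∉ G.roots F₂ := hK.2 _ (haK K hK) (haR K hK)
    rw [hπ K hK v hvK, Equiv.swap_apply_def] at hv ⊢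
    split_ifs at hv ⊢ with h1 h2
    · subst h1
      exact Or.inl ⟨haR K hK, ha', hbR K hK, hb'⟩
    · subst h2
      exact Or.inr ⟨hbR K hK, hb', haR K hK, ha'⟩
    · exact absurd rfl hv
  · obtain ⟨K, hKW, hK⟩ := exists_minimal_le_of_wellFoundedLT (G.IsSource (F₁ ∪ F₂)) W hW
    by_cases hd : ∃ v ∈ K, v ∈ G.roots F₁ ∧ v ∈ G.roots F₂
    · obtain ⟨v, hv, hv'⟩ := hd
      exact Or.inl ⟨v, hKW hv, hv'⟩
    · push Not at hd
      have hK' : 𝒦 K := ⟨hK, hd⟩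
      refine Or.inr ⟨a K, hKW (haK K hK'), hKW (hmem K hK' _ (haK K hK')), ?_⟩
      rw [hπ K hK' _ (haK K hK'), Equiv.swap_apply_left]
      exact (hab K hK').symm

theorem card_toRight_add_card_roots [Fintype V] {F : Finset (E ⊕ A)}
    (hF : G.IsMatchingForest F) : F.toRight.card + (G.roots F).card = Fintype.card V := by
  classical
  refine card_add_card_roots (head := G.head) (fun a ha h => ?_) fun v hv => ?_
  · exact mem_roots.1 h a (Finset.mem_toRight.1 ha) rfl
  · rw [mem_roots] at hv
    push Not at hv
    obtain ⟨a, ha, hav⟩ := hv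
    refine ⟨a, ⟨Finset.mem_toRight.2 ha, hav⟩, fun b hb => ?_⟩
    exact Sum.inr_injective (hF.2 v _ (Finset.mem_toRight.1 hb.1) _ ha hb.2 hav)

/-- The arcs of two matching forests can be repartitioned into branchings with prescribed root sets,
provided that the root sets have the right union and intersection and meet all source sets. -/
theorem exists_isBranching_of_roots [Fintype V] [DecidableEq V] [DecidableEq A]
    [DecidableEq (E ⊕ A)] {F₁ F₂ : Finset (E ⊕ A)} (h₁ : G.IsMatchingForest F₁)
    (h₂ : G.IsMatchingForest F₂) (hd : Disjoint F₁ F₂) {R₁ R₂ : Finset V}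
    (hun : R₁ ∪ R₂ = G.roots F₁ ∪ G.roots F₂) (hin : R₁ ∩ R₂ = G.roots F₁ ∩ G.roots F₂)
    (hs₁ : ∀ W, G.IsSource (F₁ ∪ F₂) W → ∃ v ∈ W, v ∈ R₁)
    (hs₂ : ∀ W, G.IsSource (F₁ ∪ F₂) W → ∃ v ∈ W, v ∈ R₂) :
    ∃ B₁ B₂ : Finset A, Disjoint B₁ B₂ ∧ B₁ ∪ B₂ = (F₁ ∪ F₂).toRight ∧
      IsBranching G.tail G.head B₁ R₁ ∧ IsBranching G.tail G.head B₂ R₂ := by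
  have key : ∀ (F : Finset (E ⊕ A)) (W : Finset V), W.Nonempty → ¬ G.IsSource F W →
      ∃ a, Sum.inr a ∈ F ∧ G.head a ∈ W ∧ G.tail a ∉ W := by
    intro F W hW h
    by_contra! hc
    exact h ⟨hW, hc⟩
  have hsrc : ∀ R : Finset V, (∀ W, G.IsSource (F₁ ∪ F₂) W → ∃ v ∈ W, v ∈ R) →
      ∀ W : Finset V, W.Nonempty → Disjoint W R →
        (entering G.tail G.head (F₁ ∪ F₂).toRight W).Nonempty := by
    intro R hR W hW hWR
    obtain ⟨a, ha, ha'⟩ := key (F₁ ∪ F₂) W hW fun h => by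
      obtain ⟨v, hv, hv'⟩ := hR W h
      exact Finset.disjoint_left.1 hWR hv hv'
    exact ⟨a, mem_entering.2 ⟨Finset.mem_toRight.2 ha, ha'⟩⟩
  obtain ⟨B₁, hB₁, B₂, hB₂, hB, hb₁, hb₂⟩ := exists_disjoint_isBranching
    (tail := G.tail) (head := G.head) (T := (F₁ ∪ F₂).toRight) (hsrc R₁ hs₁) (hsrc R₂ hs₂) (by
      intro W hW hW1 hW2
      have hW' : ∀ v ∈ W, v ∉ G.roots F₁ ∪ G.roots F₂ := by
        intro v hv h
        rw [← hun, Finset.mem_union] at h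
        exact h.elim (Finset.disjoint_left.1 hW1 hv) (Finset.disjoint_left.1 hW2 hv)
      obtain ⟨a, ha, ha'⟩ := key F₁ W hW fun h => by
        obtain ⟨v, hv, hv'⟩ := h.exists_mem_roots h₁.1
        exact hW' v hv (Finset.mem_union_left _ hv')
      obtain ⟨b, hb, hb'⟩ := key F₂ W hW fun h => by
        obtain ⟨v, hv, hv'⟩ := h.exists_mem_roots h₂.1
        exact hW' v hv (Finset.mem_union_right _ hv')
      refine Finset.one_lt_card.2 ⟨a, mem_entering.2 ⟨?_, ha'⟩, b, mem_entering.2 ⟨?_, hb'⟩, ?_⟩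
      · exact Finset.mem_toRight.2 (Finset.mem_union_left _ ha)
      · exact Finset.mem_toRight.2 (Finset.mem_union_right _ hb)
      · rintro rfl
        exact Finset.disjoint_left.1 hd ha hb)
  refine ⟨B₁, B₂, hB, ?_, hb₁, hb₂⟩
  -- no arc is left over, as both sides have `2 |V| - |R₁| - |R₂|` elements
  refine Finset.eq_of_subset_of_card_le (Finset.union_subset hB₁ hB₂) ?_
  have hsplit : (F₁ ∪ F₂).toRight = F₁.toRight ∪ F₂.toRight := by
    ext a
    simp
  have hle := Finset.card_union_le F₁.toRight F₂.toRight
  have e1 := card_toRight_add_card_roots h₁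
  have e2 := card_toRight_add_card_roots h₂
  have e3 := card_add_card_roots hb₁.head_notMem hb₁.existsUnique
  have e4 := card_add_card_roots hb₂.head_notMem hb₂.existsUnique
  have e5 := Finset.card_union_add_card_inter R₁ R₂
  have e6 := Finset.card_union_add_card_inter (G.roots F₁) (G.roots F₂)
  rw [hun, hin] at e5
  rw [hsplit, Finset.card_union_of_disjoint hB]
  omega

theorem isMatchingForest_disjSum {M : Finset E} {B : Finset A} {R : Finset V}
    (hB : IsBranching G.tail G.head B R)
    (hM : ∀ e ∈ M, ∀ e' ∈ M, ∀ v, v ∈ G.ends e → v ∈ G.ends e' → e = e')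
    (hR : ∀ e ∈ M, ∀ v, v ∈ G.ends e → v ∈ R) : G.IsMatchingForest (M.disjSum B) := by
  have hF : ∀ v : V, ∀ x ∈ M.disjSum B, ∀ y ∈ M.disjSum B,
      G.Covers v x → G.Covers v y → x = y := by
    rintro v (e | a) hx (e' | b) hy hvx hvy
    · rw [hM e (Finset.inl_mem_disjSum.1 hx) e' (Finset.inl_mem_disjSum.1 hy) v hvx hvy]
    · have hvy : G.head b = v := hvy
      subst hvy
      exact absurd (hR e (Finset.inl_mem_disjSum.1 hx) _ hvx)
        (hB.head_notMem b (Finset.inr_mem_disjSum.1 hy))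
    · have hvx : G.head a = v := hvx
      subst hvx
      exact absurd (hR e' (Finset.inl_mem_disjSum.1 hy) _ hvy)
        (hB.head_notMem a (Finset.inr_mem_disjSum.1 hx))
    · have hvy : G.head b = v := hvy
      subst hvy
      rw [(hB.existsUnique _ (hB.head_notMem b (Finset.inr_mem_disjSum.1 hy))).unique
        ⟨Finset.inr_mem_disjSum.1 hx, hvx⟩ ⟨Finset.inr_mem_disjSum.1 hy, rfl⟩]
  obtain ⟨h, hh⟩ := hB.exists_rank
  exact ⟨not_hasCycle_of_rank hF h fun a ha => hh a (Finset.inr_mem_disjSum.1 ha), hF⟩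

end MixedGraph

/-! ### Balancing two matching forests -/

theorem exists_sign_of_mem {ι : Type*} (P Q : ι → Prop) :
    ∃ f : ι → ℤ, ∀ i, (f i = 1 ∧ P i ∧ ¬ Q i) ∨ (f i = -1 ∧ ¬ P i ∧ Q i) ∨
      (f i = 0 ∧ (P i ↔ Q i)) := by
  classical
  refine ⟨fun i => (if P i then 1 else 0) - (if Q i then 1 else 0), fun i => ?_⟩
  by_cases h : P i <;> by_cases h' : Q i <;> simp [h, h']

theorem Finset.sum_eq_card_sub_card {ι : Type*} [Fintype ι] (f : ι → ℤ)
    (hf : ∀ i, f i = -1 ∨ f i = 0 ∨ f i = 1) :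
    ∑ i, f i = ((Finset.univ.filter fun i => f i = 1).card : ℤ) -
      (Finset.univ.filter fun i => f i = -1).card := by
  rw [Finset.card_filter, Finset.card_filter]
  push_cast
  rw [← Finset.sum_sub_distrib]
  refine Finset.sum_congr rfl fun i _ => ?_
  rcases hf i with h | h | h <;> simp [h]

theorem sign_mul_eq {a b : ℤ} (ha : a = 1 ∨ a = -1) (hb : b = -1 ∨ b = 0 ∨ b = 1) :
    a * b = -1 ∨ a * b = 0 ∨ a * b = 1 := by
  rcases ha with h | h <;> rcases hb with h' | h' | h' <;> simp [h, h']

namespace MixedGraph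

variable {V E A : Type*} {G : MixedGraph V E A}

theorem IsMatchingForest.mem_roots_of_mem_ends [Fintype V] {F : Finset (E ⊕ A)}
    (hF : G.IsMatchingForest F) {e : E} {v : V} (he : Sum.inl e ∈ F) (hv : v ∈ G.ends e) :
    v ∈ G.roots F := by
  rw [mem_roots]
  intro a ha hav
  exact Sum.inl_ne_inr (hF.2 v _ he _ ha hv hav)

/-- The undirected edges and the roots of two matching forests can be redistributed with almost
balanced sizes such that every source set keeps meeting both root sets. The new classes are indexed
by the colours `1` and `-1`; the values of `M` and `R` elsewhere play no role. -/
theorem exists_balanced_matchings_roots [Fintype V] [DecidableEq V] [Fintype E] [DecidableEq E]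
    [DecidableEq (E ⊕ A)] {F₁ F₂ : Finset (E ⊕ A)} (h₁ : G.IsMatchingForest F₁)
    (h₂ : G.IsMatchingForest F₂) (hd : Disjoint F₁ F₂) :
    ∃ (M : ℤ → Finset E) (R : ℤ → Finset V), Disjoint (M 1) (M (-1)) ∧
      M 1 ∪ M (-1) = (F₁ ∪ F₂).toLeft ∧
      (∀ c ≠ 0, ∀ e ∈ M c, ∀ e' ∈ M c, ∀ v, v ∈ G.ends e → v ∈ G.ends e' → e = e') ∧
      (∀ c ≠ 0, ∀ e ∈ M c, ∀ v, v ∈ G.ends e → v ∈ R c) ∧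
      R 1 ∪ R (-1) = G.roots F₁ ∪ G.roots F₂ ∧ R 1 ∩ R (-1) = G.roots F₁ ∩ G.roots F₂ ∧
      (∀ W, G.IsSource (F₁ ∪ F₂) W → (∃ v ∈ W, v ∈ R 1) ∧ ∃ v ∈ W, v ∈ R (-1)) ∧
      |((M 1).card : ℤ) - (M (-1)).card| ≤ 1 ∧ |((R 1).card : ℤ) - (R (-1)).card| ≤ 2 ∧
      |((M 1).card : ℤ) - (M (-1)).card - (((R 1).card : ℤ) - (R (-1)).card)| ≤ 2 := by
  obtain ⟨π, hπ, hπR, hπs⟩ := exists_involutive_forall_isSource h₁.1 h₂.1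
  have hends₁ : ∀ e v, Sum.inl e ∈ F₁ → v ∈ G.ends e → v ∈ G.roots F₁ :=
    fun e v => h₁.mem_roots_of_mem_ends
  have hends₂ : ∀ e v, Sum.inl e ∈ F₂ → v ∈ G.ends e → v ∈ G.roots F₂ :=
    fun e v => h₂.mem_roots_of_mem_ends
  generalize G.roots F₁ = R₁ at *
  generalize G.roots F₂ = R₂ at *
  obtain ⟨σ, hσ⟩ := exists_sign_of_mem (fun e : E => Sum.inl e ∈ F₁) (fun e => Sum.inl e ∈ F₂)
  obtain ⟨ρ, hρ⟩ := exists_sign_of_mem (fun v : V => v ∈ R₁) (fun v => v ∈ R₂)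
  have hσ₀ : ∀ e, σ e = 0 ↔ Sum.inl e ∉ F₁ ∧ Sum.inl e ∉ F₂ := by
    intro e
    have a := hσ e
    have b : Sum.inl e ∈ F₁ → Sum.inl e ∉ F₂ := fun h => Finset.disjoint_left.1 hd h
    grind
  have hσ' : ∀ e, σ e = -1 ∨ σ e = 0 ∨ σ e = 1 := fun e => by have := hσ e; tauto
  have hρ' : ∀ v, ρ v = -1 ∨ ρ v = 0 ∨ ρ v = 1 := fun v => by have := hρ v; tauto
  have hEE : ∀ e e' v, e ≠ e' → σ e ≠ 0 → σ e' ≠ 0 → v ∈ G.ends e → v ∈ G.ends e' →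
      σ e' = -σ e ∧ ρ v = 0 := by
    intro e e' v hne h h' hv hv'
    have n1 : Sum.inl e ∈ F₁ → Sum.inl e' ∉ F₁ :=
      fun he he' => hne (Sum.inl_injective (h₁.2 v _ he _ he' hv hv'))
    have n2 : Sum.inl e ∈ F₂ → Sum.inl e' ∉ F₂ :=
      fun he he' => hne (Sum.inl_injective (h₂.2 v _ he _ he' hv hv'))
    have a1 := hends₁ e v
    have a2 := hends₂ e v
    have a3 := hends₁ e' v
    have a4 := hends₂ e' v
    have c1 := hρ v
    have c2 := hσ e
    have c3 := hσ e'
    have c4 := hσ₀ e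
    have c5 := hσ₀ e'
    clear * - n1 n2 a1 a2 a3 a4 c1 c2 c3 c4 c5 hv hv' h h'
    grind
  have hEV : ∀ e v, v ∈ G.ends e → σ e ≠ 0 → ρ v ≠ 0 → ρ v = σ e := by
    intro e v hv h h'
    have a1 := hends₁ e v
    have a2 := hends₂ e v
    have c1 := hρ v
    have c2 := hσ e
    have c3 := hσ₀ e
    clear * - a1 a2 c1 c2 c3 hv h h'
    grind
  have hπρ : ∀ v, π v ≠ v → ρ (π v) = -ρ v ∧ ρ v ≠ 0 := by
    intro v hv
    have a1 := hπR v hv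
    have a2 := hρ v
    have a3 := hρ (π v)
    clear * - a1 a2 a3
    grind
  obtain ⟨ε, δ, hε, hδ, hεε, hεδ, hδπ, hb1, hb2, hb3⟩ :=
    exists_balanced_flip hπ hσ' hρ' hEE hEV hπρ
  have hεσ : ∀ e, ε e * σ e = -1 ∨ ε e * σ e = 0 ∨ ε e * σ e = 1 :=
    fun e => sign_mul_eq (hε e) (hσ' e)
  have hδρ : ∀ v, δ v * ρ v = -1 ∨ δ v * ρ v = 0 ∨ δ v * ρ v = 1 :=
    fun v => sign_mul_eq (hδ v) (hρ' v)
  have hε₀ : ∀ e, ε e * σ e = 0 ↔ σ e = 0 := fun e => by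
    rcases hε e with h | h <;> simp [h]
  have hδ₀ : ∀ v, δ v * ρ v = 0 ↔ ρ v = 0 := fun v => by
    rcases hδ v with h | h <;> simp [h]
  have hRcard : ∀ c : ℤ, c ≠ 0 →
      (Finset.univ.filter fun v => (v ∈ R₁ ∧ v ∈ R₂) ∨ δ v * ρ v = c).card =
      (Finset.univ.filter fun v => v ∈ R₁ ∧ v ∈ R₂).card +
        (Finset.univ.filter fun v => δ v * ρ v = c).card := by
    intro c hc
    rw [Finset.filter_or, Finset.card_union_of_disjoint]
    rw [Finset.disjoint_filter]
    intro v _ hv hv'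
    have h0 : ρ v = 0 := by
      have := hρ v
      tauto
    exact hc (by rw [← hv', h0, mul_zero])
  have hMc := Finset.sum_eq_card_sub_card _ hεσ
  have hRc := Finset.sum_eq_card_sub_card _ hδρ
  refine ⟨fun c => Finset.univ.filter fun e => ε e * σ e = c,
    fun c => Finset.univ.filter fun v => (v ∈ R₁ ∧ v ∈ R₂) ∨ δ v * ρ v = c,
    ?_, ?_, ?_, ?_, ?_, ?_, ?_, ?_⟩
  · rw [Finset.disjoint_filter]
    intro e _ h
    omega
  · ext e
    simp only [Finset.mem_union, Finset.mem_filter, Finset.mem_univ, true_and, Finset.mem_toLeft]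
    have a := hεσ e
    have b := hε₀ e
    have c := hσ₀ e
    clear * - a b c
    grind
  · intro c hc e he e' he' v hv hv'
    by_contra hne
    simp only [Finset.mem_filter, Finset.mem_univ, true_and] at he he'
    have hs : σ e ≠ 0 := fun h => hc (by rw [← he, h, mul_zero])
    have hs' : σ e' ≠ 0 := fun h => hc (by rw [← he', h, mul_zero])
    rw [← hεε e e' v hne hs hs' hv hv', (hEE e e' v hne hs hs' hv hv').1, mul_neg, he] at he'
    omega
  · intro c hc e he v hv
    simp only [Finset.mem_filter, Finset.mem_univ, true_and] at he ⊢
    have hs : σ e ≠ 0 := fun h => hc (by rw [← he, h, mul_zero])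
    by_cases h0 : ρ v = 0
    · left
      have a1 := hends₁ e v
      have a2 := hends₂ e v
      have a3 := hρ v
      have a4 := hσ₀ e
      clear * - a1 a2 a3 a4 hs h0 hv
      grind
    · right
      rw [hEV e v hv hs h0, ← hεδ e v hv hs h0, he]
  · ext v
    have a := hρ v
    have b := hδρ v
    have c := hδ₀ v
    simp only [Finset.mem_union, Finset.mem_filter, Finset.mem_univ, true_and]
    clear * - a b c
    grind
  · ext v
    have b := hδρ v
    simp only [Finset.mem_inter, Finset.mem_filter, Finset.mem_univ, true_and]
    clear * - b
    grind
  · intro W hW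
    simp only [Finset.mem_filter, Finset.mem_univ, true_and]
    rcases hπs W hW with ⟨v, hv, hv'⟩ | ⟨v, hv, hv', hne⟩
    · exact ⟨⟨v, hv, Or.inl hv'⟩, v, hv, Or.inl hv'⟩
    · obtain ⟨h1, h2⟩ := hπρ v hne
      have h3 : δ (π v) * ρ (π v) = -(δ v * ρ v) := by rw [hδπ, h1, mul_neg]
      rcases hδρ v with h | h | h
      · exact ⟨⟨π v, hv', Or.inr (by omega)⟩, v, hv, Or.inr h⟩
      · exact absurd ((hδ₀ v).1 h) h2
      · exact ⟨⟨v, hv, Or.inr h⟩, π v, hv', Or.inr (by omega)⟩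
  · rw [hRcard 1 (by norm_num), hRcard (-1) (by norm_num)]
    rw [hMc] at hb1 hb3
    rw [hRc] at hb2 hb3
    push_cast
    rw [add_sub_add_left_eq_sub]
    exact ⟨hb1, hb2, hb3⟩

/-- The case of two matching forests: their union can be repartitioned in a balanced way. -/
theorem exists_balanced_pair [Finite V] [Finite E] [DecidableEq (E ⊕ A)]
    {F₁ F₂ : Finset (E ⊕ A)} (h₁ : G.IsMatchingForest F₁)
    (h₂ : G.IsMatchingForest F₂) (hd : Disjoint F₁ F₂) :
    ∃ F₁' F₂' : Finset (E ⊕ A), G.IsMatchingForest F₁' ∧ G.IsMatchingForest F₂' ∧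
      Disjoint F₁' F₂' ∧ F₁' ∪ F₂' = F₁ ∪ F₂ ∧
      |(F₁'.card : ℤ) - F₂'.card| ≤ 2 ∧ |(F₁'.toLeft.card : ℤ) - F₂'.toLeft.card| ≤ 1 ∧
      |(F₁'.toRight.card : ℤ) - F₂'.toRight.card| ≤ 2 := by
  classical
  have := Fintype.ofFinite V
  have := Fintype.ofFinite E
  obtain ⟨M, R, hM, hMun, hMc, hMR, hun, hin, hsrc, hb1, hb2, hb3⟩ :=
    exists_balanced_matchings_roots h₁ h₂ hd
  obtain ⟨B₁, B₂, hB, hBun, hB₁, hB₂⟩ := exists_isBranching_of_roots h₁ h₂ hd hun hin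
    (fun W hW => (hsrc W hW).1) (fun W hW => (hsrc W hW).2)
  have e1 := card_add_card_roots hB₁.head_notMem hB₁.existsUnique
  have e2 := card_add_card_roots hB₂.head_notMem hB₂.existsUnique
  refine ⟨(M 1).disjSum B₁, (M (-1)).disjSum B₂,
    isMatchingForest_disjSum hB₁ (hMc 1 (by norm_num)) (hMR 1 (by norm_num)),
    isMatchingForest_disjSum hB₂ (hMc (-1) (by norm_num)) (hMR (-1) (by norm_num)), ?_, ?_, ?_⟩
  · rw [Finset.disjoint_left]
    rintro (e | a) h h'
    · exact Finset.disjoint_left.1 hM (Finset.inl_mem_disjSum.1 h) (Finset.inl_mem_disjSum.1 h')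
    · exact Finset.disjoint_left.1 hB (Finset.inr_mem_disjSum.1 h) (Finset.inr_mem_disjSum.1 h')
  · ext x
    rcases x with e | a
    · rw [← Finset.mem_toLeft, ← Finset.mem_toLeft, ← hMun]
      simp
    · rw [← Finset.mem_toRight, ← Finset.mem_toRight, ← hBun]
      simp
  · simp only [Finset.card_disjSum, Finset.toLeft_disjSum, Finset.toRight_disjSum]
    rw [abs_le] at hb1 hb2 hb3 ⊢
    rw [abs_le, abs_le]
    push_cast
    omega

end MixedGraph

/-! ### Balancing a partition -/

theorem sq_add_sq_le_of_abs_sub_le {a b c d : ℕ} (h : a + b = c + d)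
    (h' : |(c : ℤ) - d| ≤ |(a : ℤ) - b|) : c ^ 2 + d ^ 2 ≤ a ^ 2 + b ^ 2 := by
  have h1 := sq_le_sq.2 h'
  zify at h ⊢
  nlinarith

theorem sq_add_sq_lt_of_abs_sub_lt {a b c d : ℕ} (h : a + b = c + d)
    (h' : |(c : ℤ) - d| < |(a : ℤ) - b|) : c ^ 2 + d ^ 2 < a ^ 2 + b ^ 2 := by
  have h1 := sq_lt_sq.2 h'
  zify at h ⊢
  nlinarith

theorem Fintype.sum_add_add_eq_of_eq_off {ι : Type*} [Fintype ι] {f g : ι → ℕ} {i j : ι}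
    (hij : i ≠ j) (h : ∀ l, l ≠ i → l ≠ j → f l = g l) :
    ∑ l, f l + (g i + g j) = ∑ l, g l + (f i + f j) := by
  classical
  have key : ∀ f : ι → ℕ, ∑ l, f l = f i + (f j + ∑ l ∈ (Finset.univ.erase i).erase j, f l) := by
    intro f
    rw [← Finset.add_sum_erase _ _ (Finset.mem_univ i), ← Finset.add_sum_erase _ f
      (Finset.mem_erase.2 ⟨hij.symm, Finset.mem_univ j⟩)]
  have hr : ∑ l ∈ (Finset.univ.erase i).erase j, f l =
      ∑ l ∈ (Finset.univ.erase i).erase j, g l :=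
    Finset.sum_congr rfl fun l hl => h l (Finset.mem_erase.1 (Finset.mem_erase.1 hl).2).1
      (Finset.mem_erase.1 hl).1
  rw [key f, key g, hr]
  ring

namespace MixedGraph

variable {V E A : Type*} {G : MixedGraph V E A}

/-- Two members of a partition into matching forests can be replaced by balanced ones. -/
theorem IsMatchingForestPartition.exists_balance [Finite V] [Finite E] {k : ℕ}
    {F : Fin k → Finset (E ⊕ A)} (hF : G.IsMatchingForestPartition F) {i j : Fin k} (hij : i ≠ j) :
    ∃ F' : Fin k → Finset (E ⊕ A), G.IsMatchingForestPartition F' ∧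
      (∀ l, l ≠ i → l ≠ j → F' l = F l) ∧
      (F i).toLeft.card + (F j).toLeft.card = (F' i).toLeft.card + (F' j).toLeft.card ∧
      (F i).toRight.card + (F j).toRight.card = (F' i).toRight.card + (F' j).toRight.card ∧
      |((F' i).card : ℤ) - (F' j).card| ≤ 2 ∧
      |((F' i).toLeft.card : ℤ) - (F' j).toLeft.card| ≤ 1 ∧
      |((F' i).toRight.card : ℤ) - (F' j).toRight.card| ≤ 2 := by
  classical
  have hd : Disjoint (F i) (F j) := by
    rw [Finset.disjoint_left]
    intro x hx hx'
    exact hij ((hF.2 x).unique hx hx')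
  obtain ⟨F₁, F₂, h₁, h₂, hd', hun, hb⟩ := exists_balanced_pair (hF.1 i) (hF.1 j) hd
  have hmem : ∀ x, x ∈ F₁ ∨ x ∈ F₂ ↔ x ∈ F i ∨ x ∈ F j := by
    intro x
    rw [← Finset.mem_union, hun, Finset.mem_union]
  have hcard : ∀ {X Y : Finset (E ⊕ A)}, Disjoint X Y →
      (X ∪ Y).toLeft.card = X.toLeft.card + Y.toLeft.card ∧
      (X ∪ Y).toRight.card = X.toRight.card + Y.toRight.card := by
    intro X Y h
    rw [Finset.disjoint_left] at h
    constructor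
    · rw [Finset.toLeft_union, Finset.card_union_of_disjoint]
      rw [Finset.disjoint_left]
      intro e he he'
      exact h (Finset.mem_toLeft.1 he) (Finset.mem_toLeft.1 he')
    · rw [Finset.toRight_union, Finset.card_union_of_disjoint]
      rw [Finset.disjoint_left]
      intro e he he'
      exact h (Finset.mem_toRight.1 he) (Finset.mem_toRight.1 he')
  obtain ⟨F', hi, hj, hl⟩ : ∃ F' : Fin k → Finset (E ⊕ A), F' i = F₁ ∧ F' j = F₂ ∧
      ∀ l, l ≠ i → l ≠ j → F' l = F l := by
    refine ⟨Function.update (Function.update F i F₁) j F₂, by simp [hij], by simp, ?_⟩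
    intro l h h'
    simp [h, h']
  refine ⟨F', ⟨fun l => ?_, fun x => ?_⟩, hl, ?_, ?_, ?_⟩
  · by_cases h : l = i
    · rwa [h, hi]
    · by_cases h' : l = j
      · rwa [h', hj]
      · rw [hl l h h']
        exact hF.1 l
  · have hx := hmem x
    have hxd : x ∈ F₁ → x ∉ F₂ := fun h => Finset.disjoint_left.1 hd' h
    obtain ⟨l, hlx, hu⟩ := hF.2 x
    have hother : ∀ m, m ≠ i → m ≠ j → x ∈ F' m → m = l := fun m h h' hm =>
      hu m (by rwa [hl m h h'] at hm)
    by_cases hlij : l = i ∨ l = j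
    · have hx' : x ∈ F₁ ∨ x ∈ F₂ := hx.2 (by rcases hlij with rfl | rfl <;> tauto)
      have hno : ∀ m, x ∈ F' m → m = i ∨ m = j := by
        intro m hm
        by_contra! hc
        have := hother m hc.1 hc.2 hm
        rw [this] at hc
        tauto
      rcases hx' with h | h
      · refine ⟨i, by rwa [← hi] at h, fun m (hm : x ∈ F' m) => (hno m hm).resolve_right ?_⟩
        rintro rfl
        rw [hj] at hm
        exact hxd h hm
      · refine ⟨j, by rwa [← hj] at h, fun m (hm : x ∈ F' m) => (hno m hm).resolve_left ?_⟩
        rintro rfl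
        rw [hi] at hm
        exact hxd hm h
    · push Not at hlij
      have hni : x ∉ F i := fun h => hlij.1 (hu i h).symm
      have hnj : x ∉ F j := fun h => hlij.2 (hu j h).symm
      refine ⟨l, by rwa [← hl l hlij.1 hlij.2] at hlx, fun m (hm : x ∈ F' m) => hother m ?_ ?_ hm⟩
      · rintro rfl
        rw [hi] at hm
        tauto
      · rintro rfl
        rw [hj] at hm
        tauto
  · rw [hi, hj, ← (hcard hd).1, ← (hcard hd').1, hun]
  · rw [hi, hj, ← (hcard hd).2, ← (hcard hd').2, hun]
  · rw [hi, hj]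
    exact hb

end MixedGraph

theorem theorem2 {V E A : Type*} [Finite V] [Finite E] [Finite A]
    (G : MixedGraph V E A) (k : ℕ)
    (hG : ∃ F : Fin k → Finset (E ⊕ A), G.IsMatchingForestPartition F) :
    ∃ F : Fin k → Finset (E ⊕ A), G.IsMatchingForestPartition F ∧
      ∀ i j : Fin k,
        |((F i).card : ℤ) - ((F j).card : ℤ)| ≤ 2 ∧
        |((F i).toLeft.card : ℤ) - ((F j).toLeft.card : ℤ)| ≤ 1 ∧
        |((F i).toRight.card : ℤ) - ((F j).toRight.card : ℤ)| ≤ 2 := by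
  obtain ⟨F, hF, hmin⟩ := exists_minimalFor_of_wellFoundedLT
    (fun F : Fin k → Finset (E ⊕ A) => G.IsMatchingForestPartition F)
    (fun F => toLex (∑ l, (F l).toLeft.card ^ 2,
      ∑ l, (F l).card ^ 2 + ∑ l, (F l).toRight.card ^ 2)) hG
  refine ⟨F, hF, fun i j => ?_⟩
  by_cases hij : i = j
  · subst hij
    simp
  obtain ⟨F', hF', hl, hM, hB, hb⟩ := hF.exists_balance hij
  obtain ⟨hbF, hbM, hbB⟩ := hb
  have hsumM := Fintype.sum_add_add_eq_of_eq_off (f := fun l => (F' l).toLeft.card ^ 2)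
    (g := fun l => (F l).toLeft.card ^ 2) hij fun l h h' => by rw [hl l h h']
  have hsumB := Fintype.sum_add_add_eq_of_eq_off (f := fun l => (F' l).toRight.card ^ 2)
    (g := fun l => (F l).toRight.card ^ 2) hij fun l h h' => by rw [hl l h h']
  have hsumF := Fintype.sum_add_add_eq_of_eq_off (f := fun l => (F' l).card ^ 2)
    (g := fun l => (F l).card ^ 2) hij fun l h h' => by rw [hl l h h']
  have hle : ∑ l, (F l).toLeft.card ^ 2 < ∑ l, (F' l).toLeft.card ^ 2 ∨
      ∑ l, (F l).toLeft.card ^ 2 = ∑ l, (F' l).toLeft.card ^ 2 ∧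
      ∑ l, (F l).card ^ 2 + ∑ l, (F l).toRight.card ^ 2 ≤
        ∑ l, (F' l).card ^ 2 + ∑ l, (F' l).toRight.card ^ 2 :=
    Prod.Lex.toLex_le_toLex.1 ((le_total _ _).elim id (hmin hF'))
  have hcF : (F i).card + (F j).card = (F' i).card + (F' j).card := by
    have h1 := Finset.card_toLeft_add_card_toRight (u := F i)
    have h2 := Finset.card_toLeft_add_card_toRight (u := F j)
    have h3 := Finset.card_toLeft_add_card_toRight (u := F' i)
    have h4 := Finset.card_toLeft_add_card_toRight (u := F' j)
    omega
  have hci := Finset.card_toLeft_add_card_toRight (u := F i)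
  have hcj := Finset.card_toLeft_add_card_toRight (u := F j)
  -- the parity of the difference is kept, and the new difference is the least of its parity
  have hMle := sq_add_sq_le_of_abs_sub_le hM (by
    simp only [Int.abs_eq_natAbs] at hbM ⊢
    omega)
  have hMd : |((F i).toLeft.card : ℤ) - (F j).toLeft.card| ≤ 1 := by
    by_contra! hc
    have := sq_add_sq_lt_of_abs_sub_lt hM (hbM.trans_lt hc)
    omega
  have hBd : |((F i).toRight.card : ℤ) - (F j).toRight.card| ≤ 2 := by
    by_contra! hc
    have h1 := sq_add_sq_lt_of_abs_sub_lt hB (hbB.trans_lt hc)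
    -- edges compensate at most one of the (at least three) surplus arcs
    have h2 := sq_add_sq_le_of_abs_sub_le hcF (hbF.trans (by
      simp only [Int.abs_eq_natAbs] at hMd hc ⊢
      omega))
    omega
  refine ⟨?_, hMd, hBd⟩
  by_contra! hc
  have h1 := sq_add_sq_lt_of_abs_sub_lt hcF (hbF.trans_lt hc)
  have h2 := sq_add_sq_le_of_abs_sub_le hB (hbB.trans (by
    simp only [Int.abs_eq_natAbs] at hMd hc ⊢
    omega))
  omega
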